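/- Let $\nu,d\ge 0$ be integers. Let $[-\pi,\pi)^\nu$ denote the $\nu$-dimensional torus (the coordinates $-\pi$ and $\pi$ are identified) with its Borel $\sigma$-algebra. A complex measure on it has finite total variation if its real and imaginary parts are differences of two finite measures. A random field $X(p)=(X_1(p),\dots,X_d(p))$, $p\in\mathbb Z^\nu$, with real coordinates is stationary if for every $m\in\mathbb Z^\nu$ the field $p\mapsto X(p+m)$ has the same finite dimensional distributions as $X$, and Gaussian if all vectors $(X(p_1),\dots,X(p_k))$ are (jointly) Gaussian. For complex measures $G_{j,j'}$, $1\le j,j'\le d$, of finite total variation on the torus, the matrix valued measure $(G_{j,j'})$ is called positive semidefinite if there is a finite measure $\mu$ on the torus such that every $G_{j,j'}$ is absolutely continuous with respect to $\mu$ and the matrix $\bigl(\frac{dG_{j,j'}}{d\mu}(x)\bigr)_{1\le j,j'\le d}$ is positive semidefinite for $\mu$-almost all $x$; it is called even if $G_{j,j'}(-A)=\overline{G_{j,j'}(A)}$ for all measurable $A$ and all $j,j'$. (i) Let $X(p)$, $p\in\mathbb Z^\nu$, be a $d$-dimensional stationary random field with finite second moments and expectation zero, and put $r_{j,j'}(p)=EX_j(0)X_{j'}(p)$.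 Then there are complex measures $G_{j,j'}$, $1\le j,j'\le d$, with finite total variation on the torus such that for all $1\le j,j'\le d$ and $p,m\in\mathbb Z^\nu$ $$r_{j,j'}(p)=EX_j(0)X_{j'}(p)=EX_j(m)X_{j'}(m+p)=\int_{[-\pi,\pi)^\nu}e^{i(p,x)}\,G_{j,j'}(dx).$$ They satisfy $G_{j',j}(A)=\overline{G_{j,j'}(A)}$ and $G_{j,j'}(-A)=\overline{G_{j,j'}(A)}$ for all $1\le j,j'\le d$ and all measurable sets $A$. For each pair $(j,j')$ the function $r_{j,j'}$ determines uniquely the complex measure $G_{j,j'}$ of which it is the Fourier transform. There are finite measures $\mu$ on the torus with respect to which all $G_{j,j'}$ are absolutely continuous, and for every such $\mu$ the matrix $\bigl(\frac{dG_{j,j'}}{d\mu}(x)\bigr)_{1\le j,j'\le d}$ is positive semidefinite for $\mu$-almost all $x$. (ii) Conversely, let $(G_{j,j'})$, $1\le j,j'\le d$, be a positive semidefinite, even matrix valued measure on the torus whose entries are complex measures with finite total variation, and put $r_{j,j'}(p)=\int_{[-\pi,\pi)^\nu} e^{i(p,x)}\,G_{j,j'}(dx)$. Then there is a $d$-dimensional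 stationary Gaussian field $X(p)$, $p\in\mathbb Z^\nu$, with $EX_j(p)=0$ and $EX_j(p)X_{j'}(q)=r_{j,j'}(q-p)$ for all $j,j',p,q$ (so that $EX_j(0)X_{j'}(p)=r_{j,j'}(p)$). There is likewise such a field with $EX_j(p)X_{j'}(q)=r_{j,j'}(p-q)$ for all $j,j',p,q$. -/

import Mathlib

open MeasureTheory ProbabilityTheory
open scoped ComplexOrder Pointwise ComplexConjugate

noncomputable section

/-- The torus `[-π, π)^ν`, i.e. `[-π, π]^ν` with the endpoints `-π` and `π` identified in every
coordinate: the `ν`-fold product of the circle `ℝ / 2πℤ`, with its Borel `σ`-algebra. -/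
abbrev Torus (ν : ℕ) : Type := Fin ν → AddCircle (2 * Real.pi)

/-- The character `x ↦ e^{i(p,x)}` of the torus, `p ∈ ℤ^ν`. -/
def torusChar {ν : ℕ} (p : Fin ν → ℤ) (x : Torus ν) : ℂ := ∏ k, fourier (p k) (x k)

/-- On representatives `x ∈ ℝ^ν` the character is `e^{i(p,x)}` with `(p,x) = ∑ p_k x_k`. -/
theorem torusChar_coe {ν : ℕ} (p : Fin ν → ℤ) (x : Fin ν → ℝ) :
    torusChar p (fun k => (x k : AddCircle (2 * Real.pi))) =
      Complex.exp (Complex.I * ∑ k, (p k : ℂ) * (x k : ℂ)) := by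
  have hpi : (Real.pi : ℂ) ≠ 0 := by exact_mod_cast Real.pi_ne_zero
  rw [torusChar, Finset.mul_sum, Complex.exp_sum]
  refine Finset.prod_congr rfl fun k _ => ?_
  rw [fourier_coe_apply]
  congr 1
  push_cast
  field_simp

/-- A complex measure has finite total variation if its real and its imaginary part are both
differences of two finite (positive) measures. -/
def HasFiniteTotalVariation {α : Type*} [MeasurableSpace α] (G : ComplexMeasure α) : Prop :=
  (∃ (μ₁ μ₂ : Measure α) (_ : IsFiniteMeasure μ₁) (_ : IsFiniteMeasure μ₂),
    ComplexMeasure.re G = μ₁.toSignedMeasure - μ₂.toSignedMeasure) ∧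
  (∃ (μ₁ μ₂ : Measure α) (_ : IsFiniteMeasure μ₁) (_ : IsFiniteMeasure μ₂),
    ComplexMeasure.im G = μ₁.toSignedMeasure - μ₂.toSignedMeasure)

/-- Every (`ℂ`-valued, countably additive) complex measure has finite total variation, so this
property need not be assumed separately of a `ComplexMeasure`. -/
theorem hasFiniteTotalVariation_complexMeasure {α : Type*} [MeasurableSpace α]
    (G : ComplexMeasure α) : HasFiniteTotalVariation G :=
  ⟨⟨_, _, (ComplexMeasure.re G).toJordanDecomposition.posPart_finite,
      (ComplexMeasure.re G).toJordanDecomposition.negPart_finite,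
      (SignedMeasure.toSignedMeasure_toJordanDecomposition _).symm⟩,
    ⟨_, _, (ComplexMeasure.im G).toJordanDecomposition.posPart_finite,
      (ComplexMeasure.im G).toJordanDecomposition.negPart_finite,
      (SignedMeasure.toSignedMeasure_toJordanDecomposition _).symm⟩⟩

/-- The Fourier transform `p ↦ ∫ e^{i(p,x)} G(dx)` of a complex measure on the torus. -/
def torusFourier {ν : ℕ} (G : ComplexMeasure (Torus ν)) (p : Fin ν → ℤ) : ℂ :=
  G.integral (torusChar p) (ContinuousLinearMap.mul ℝ ℂ)

/-- A matrix `(G_{j,j'})` of complex measures on the torus. -/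
abbrev MatrixMeasure (ν d : ℕ) : Type := Fin d → Fin d → ComplexMeasure (Torus ν)

namespace MatrixMeasure

variable {ν d : ℕ}

/-- `G_{j',j}(A) = conj G_{j,j'}(A)`. -/
def IsHermitian (G : MatrixMeasure ν d) : Prop :=
  ∀ (j j' : Fin d) (A : Set (Torus ν)), MeasurableSet A → G j' j A = conj (G j j' A)

/-- `G_{j,j'}(-A) = conj G_{j,j'}(A)`. -/
def IsEven (G : MatrixMeasure ν d) : Prop :=
  ∀ (j j' : Fin d) (A : Set (Torus ν)), MeasurableSet A → G j j' (-A) = conj (G j j' A)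

/-- All the `G_{j,j'}` are absolutely continuous with respect to `μ`. -/
def IsDominatedBy (G : MatrixMeasure ν d) (μ : Measure (Torus ν)) : Prop :=
  ∀ j j' : Fin d, VectorMeasure.AbsolutelyContinuous (G j j') μ.toENNRealVectorMeasure

/-- The matrix `(g_{j,j'}(x))` of Radon–Nikodym derivatives `g_{j,j'} = dG_{j,j'}/dμ`. -/
def density (G : MatrixMeasure ν d) (μ : Measure (Torus ν)) (x : Torus ν) :
    Matrix (Fin d) (Fin d) ℂ :=
  Matrix.of fun j j' => ComplexMeasure.rnDeriv (G j j') μ x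

/-- The matrix valued measure is positive semidefinite: for some finite dominating measure `μ` the
matrix of Radon–Nikodym derivatives is positive semidefinite `μ`-almost everywhere. -/
def IsPosSemidef (G : MatrixMeasure ν d) : Prop :=
  ∃ μ : Measure (Torus ν), IsFiniteMeasure μ ∧ G.IsDominatedBy μ ∧
    ∀ᵐ x ∂μ, (G.density μ x).PosSemidef

end MatrixMeasure

/-- A `d`-dimensional real random field on `ℤ^ν`. -/
abbrev RandomField (ν d : ℕ) (Ω : Type*) : Type _ :=
  (Fin ν → ℤ) → Ω → EuclideanSpace ℝ (Fin d)

namespace RandomField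

variable {ν d : ℕ} {Ω : Type*} [MeasurableSpace Ω]

/-- Stationarity: every shift `p ↦ X(p+m)` of the field has the same finite dimensional
distributions as the field itself. -/
def IsStationary (X : RandomField ν d Ω) (P : Measure Ω) : Prop :=
  ∀ (m : Fin ν → ℤ) (I : Finset (Fin ν → ℤ)),
    IdentDistrib (fun ω (p : I) => X (p + m) ω) (fun ω (p : I) => X p ω) P P

/-- Zero expectation: `E X_j(p) = 0`. -/
def IsCentered (X : RandomField ν d Ω) (P : Measure Ω) : Prop :=
  ∀ (p : Fin ν → ℤ) (j : Fin d), Integrable (fun ω => X p ω j) P ∧ ∫ ω, X p ω j ∂P = 0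

/-- The mixed second moment `E X_j(p) X_{j'}(q)`. -/
def mixedMoment (X : RandomField ν d Ω) (P : Measure Ω) (j j' : Fin d) (p q : Fin ν → ℤ) : ℝ :=
  ∫ ω, X p ω j * X q ω j' ∂P

/-- The correlation function `r_{j,j'}(p) = E X_j(0) X_{j'}(p)`. -/
def corr (X : RandomField ν d Ω) (P : Measure Ω) (j j' : Fin d) (p : Fin ν → ℤ) : ℝ :=
  X.mixedMoment P j j' 0 p

end RandomField

end

/-! ### Complex measures with a density -/

section ComplexMeasureDensity

variable {α : Type*} [MeasurableSpace α]

/-! The coordinates of a stationary field are vectors of complex `L²` whose inner products depend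
only on `q - p`. For one such family Herglotz's theorem gives a positive spectral measure: the Fejér
densities `‖∑ e^{-i(p,x)} v p‖² / N^ν` against Haar measure have Fourier coefficients tending to `r`
and bounded mass, so compactness supplies a limit point
(`exists_isFiniteMeasure_integral_torusChar_eq`). Polarization yields the off-diagonal entries.

Trigonometric polynomials are uniformly dense, so a complex measure is determined by its Fourier
transform (`torusFourier_injective`). Hermitian symmetry and evenness then reduce to identities for
`r`. Positivity also follows: `∑ conj (c j) * c j' • G j j'` must be the spectral measure of `∑ c j
• v j`, hence is nonnegative, and countably many `c` suffice to make the density positive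
semidefinite almost everywhere (`ae_posSemidef_density`).

Conversely, integrating the quadratic form of the density at `z = c_{j,p} e^{i(p,x)}` shows that
`r_{j,j'}(q - p)`, real by evenness, is a positive semidefinite kernel (`IsPosSemidef.sum_nonneg`).
Such a kernel is a Gram matrix, realized by Gram–Schmidt as the covariance of finite combinations of
independent standard normals. A centered Gaussian law depends only on its covariance, which gives
stationarity; reflecting `p` to `-p` gives the other sign convention. -/

theorem isFiniteMeasure_variation_withDensityᵥ {μ : Measure α} {g : α → ℂ} (hg : Integrable g μ) :
    IsFiniteMeasure (μ.withDensityᵥ g).variation := by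
  rw [Measure.variation_withDensityᵥ hg]
  exact isFiniteMeasure_withDensity hg.2.ne

theorem simpleFunc_integral_withDensityᵥ {μ : Measure α} {g : α → ℂ} (hg : Integrable g μ)
    (f : SimpleFunc α ℂ) :
    (μ.withDensityᵥ g).integral f (ContinuousLinearMap.mul ℝ ℂ) = ∫ x, f x * g x ∂μ := by
  have hfin := isFiniteMeasure_variation_withDensityᵥ hg
  induction f using SimpleFunc.induction with
  | @const c s hs =>
    have h1 : (SimpleFunc.piecewise s hs (SimpleFunc.const α c) (SimpleFunc.const α 0) : α → ℂ)
        = s.indicator fun _ => c := by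
      ext x; by_cases hx : x ∈ s <;> simp [hx]
    rw [h1, VectorMeasure.integral_indicator hs, VectorMeasure.integral_const]
    have h2 : (fun x => s.indicator (fun _ => c) x * g x) = s.indicator fun x => c * g x := by
      ext x; by_cases hx : x ∈ s <;> simp [hx]
    rw [h2, MeasureTheory.integral_indicator hs, MeasureTheory.integral_const_mul]
    simp [withDensityᵥ_apply hg hs]
  | @add f₁ f₂ _ h1 h2 =>
    have hi : ∀ f : SimpleFunc α ℂ, Integrable (fun x => f x * g x) μ := fun f => by
      obtain ⟨C, hC⟩ := f.exists_forall_norm_le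
      exact hg.bdd_mul f.aestronglyMeasurable (Filter.Eventually.of_forall hC)
    have hi' : ∀ f : SimpleFunc α ℂ, (μ.withDensityᵥ g).Integrable f := fun f =>
      f.integrable_of_isFiniteMeasure
    rw [SimpleFunc.coe_add]
    rw [VectorMeasure.integral_add (hi' f₁) (hi' f₂), h1, h2, ← integral_add (hi f₁) (hi f₂)]
    simp [add_mul]

/-- Bounded simple approximants reduce this to simple functions, by dominated convergence on both
sides. It turns Fourier transforms of complex measures into ordinary integrals. -/
theorem integral_withDensityᵥ {μ : Measure α} {g : α → ℂ} (hg : Integrable g μ) {f : α → ℂ}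
    (hf : StronglyMeasurable f) {C : ℝ} (hC : ∀ x, ‖f x‖ ≤ C) :
    (μ.withDensityᵥ g).integral f (ContinuousLinearMap.mul ℝ ℂ) = ∫ x, f x * g x ∂μ := by
  have hfin := isFiniteMeasure_variation_withDensityᵥ hg
  -- A point is needed to know that `0 ≤ C`.
  rcases isEmpty_or_nonempty α with hα | ⟨⟨x₀⟩⟩
  · rw [VectorMeasure.integral_of_isEmpty, Measure.eq_zero_of_isEmpty μ, integral_zero_measure]
  have hC0 : 0 ≤ C := (norm_nonneg _).trans (hC x₀)
  have hlim : ∀ x, Filter.Tendsto (fun n => hf.approxBounded C n x) Filter.atTop (nhds (f x)) :=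
    fun x => hf.tendsto_approxBounded_of_norm_le (hC x)
  have hbd : ∀ n x, ‖hf.approxBounded C n x‖ ≤ C := fun n x => hf.norm_approxBounded_le hC0 n x
  have h1 : Filter.Tendsto
      (fun n => (μ.withDensityᵥ g).integral (hf.approxBounded C n) (ContinuousLinearMap.mul ℝ ℂ))
      Filter.atTop (nhds ((μ.withDensityᵥ g).integral f (ContinuousLinearMap.mul ℝ ℂ))) :=
    VectorMeasure.tendsto_integral_filter_of_norm_le_const
      (Filter.Eventually.of_forall fun n => (hf.approxBounded C n).aestronglyMeasurable)
      ⟨C, Filter.Eventually.of_forall fun n => Filter.Eventually.of_forall (hbd n)⟩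
      (Filter.Eventually.of_forall hlim)
  have h2 : Filter.Tendsto (fun n => ∫ x, hf.approxBounded C n x * g x ∂μ)
      Filter.atTop (nhds (∫ x, f x * g x ∂μ)) := by
    refine tendsto_integral_of_dominated_convergence (fun x => C * ‖g x‖)
      (fun n => (hf.approxBounded C n).aestronglyMeasurable.mul hg.aestronglyMeasurable)
      (hg.norm.const_mul C) (fun n => Filter.Eventually.of_forall fun x => ?_)
      (Filter.Eventually.of_forall fun x => (hlim x).mul_const _)
    rw [norm_mul]
    exact mul_le_mul_of_nonneg_right (hbd n x) (norm_nonneg _)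
  simp only [simpleFunc_integral_withDensityᵥ hg] at h1
  exact tendsto_nhds_unique h1 h2

/-! ### Domination, densities and conjugation of complex measures. -/

namespace MeasureTheory.ComplexMeasure

theorem withDensityᵥ_rnDeriv_eq (G : ComplexMeasure α) (μ : Measure α) [SigmaFinite μ]
    (h : VectorMeasure.AbsolutelyContinuous G μ.toENNRealVectorMeasure) :
    μ.withDensityᵥ (G.rnDeriv μ) = G := by
  rw [absolutelyContinuous_ennreal_iff] at h
  have hi := G.integrable_rnDeriv μ
  ext s hs
  rw [withDensityᵥ_apply hi hs]
  apply Complex.ext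
  · rw [← RCLike.re_eq_complex_re, ← integral_re hi.integrableOn, RCLike.re_eq_complex_re]
    have := congrArg (fun s' : SignedMeasure α => s' s)
      (SignedMeasure.withDensityᵥ_rnDeriv_eq _ μ h.1)
    rw [withDensityᵥ_apply (SignedMeasure.integrable_rnDeriv _ _) hs] at this
    exact this
  · rw [← RCLike.im_eq_complex_im, ← integral_im hi.integrableOn, RCLike.im_eq_complex_im]
    have := congrArg (fun s' : SignedMeasure α => s' s)
      (SignedMeasure.withDensityᵥ_rnDeriv_eq _ μ h.2)
    rw [withDensityᵥ_apply (SignedMeasure.integrable_rnDeriv _ _) hs] at this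
    exact this

/-- A finite measure dominating a complex measure. -/
noncomputable def dominating (G : ComplexMeasure α) : Measure α :=
  (re G).totalVariation + (im G).totalVariation

instance (G : ComplexMeasure α) : IsFiniteMeasure G.dominating := by
  unfold dominating; infer_instance

theorem apply_eq_zero_of_dominating (G : ComplexMeasure α) {s : Set α} (hs : G.dominating s = 0) :
    G s = 0 := by
  rw [dominating, Measure.add_apply, add_eq_zero] at hs
  apply Complex.ext
  · have := SignedMeasure.norm_le_totalVariation (re G) s
    rw [Measure.real, hs.1, ENNReal.toReal_zero] at this
    exact norm_le_zero_iff.1 this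
  · have := SignedMeasure.norm_le_totalVariation (im G) s
    rw [Measure.real, hs.2, ENNReal.toReal_zero] at this
    exact norm_le_zero_iff.1 this

theorem absolutelyContinuous_of_dominating_le (G : ComplexMeasure α) {μ : Measure α}
    (h : G.dominating ≤ μ) :
    VectorMeasure.AbsolutelyContinuous G μ.toENNRealVectorMeasure := by
  refine VectorMeasure.AbsolutelyContinuous.mk fun s hs h0 => ?_
  rw [Measure.toENNRealVectorMeasure_apply_measurable hs] at h0
  exact G.apply_eq_zero_of_dominating (le_antisymm ((h s).trans_eq h0) zero_le)

theorem exists_eq_withDensityᵥ (G : ComplexMeasure α) :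
    ∃ (μ : Measure α) (g : α → ℂ), IsFiniteMeasure μ ∧ Integrable g μ ∧ μ.withDensityᵥ g = G :=
  ⟨G.dominating, G.rnDeriv _, inferInstance, G.integrable_rnDeriv _,
    G.withDensityᵥ_rnDeriv_eq _ (G.absolutelyContinuous_of_dominating_le le_rfl)⟩

instance isFiniteMeasure_variation (G : ComplexMeasure α) : IsFiniteMeasure G.variation := by
  obtain ⟨μ, g, -, hg, rfl⟩ := G.exists_eq_withDensityᵥ
  exact isFiniteMeasure_variation_withDensityᵥ hg

/-- The complex conjugate of a complex measure. -/
noncomputable def conjugate (G : ComplexMeasure α) : ComplexMeasure α :=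
  G.mapRange (starRingEnd ℂ : ℂ →+* ℂ).toAddMonoidHom Complex.continuous_conj

theorem conjugate_apply (G : ComplexMeasure α) (s : Set α) : G.conjugate s = conj (G s) := rfl

theorem conjugate_withDensityᵥ {μ : Measure α} {g : α → ℂ} (hg : Integrable g μ) :
    conjugate (μ.withDensityᵥ g) = μ.withDensityᵥ fun x => conj (g x) := by
  ext s hs
  rw [conjugate_apply, withDensityᵥ_apply hg hs, withDensityᵥ_apply _ hs, integral_conj]
  exact (LinearIsometryEquiv.integrable_comp_iff Complex.conjLIE).2 hg

end MeasureTheory.ComplexMeasure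

end ComplexMeasureDensity

/-! ### The Fourier transform on the torus -/

section Fourier

variable {ν : ℕ}

instance : Fact (0 < 2 * Real.pi) := ⟨Real.two_pi_pos⟩

theorem continuous_torusChar (p : Fin ν → ℤ) : Continuous (torusChar p) := by
  unfold torusChar; fun_prop

theorem norm_torusChar (p : Fin ν → ℤ) (x : Torus ν) : ‖torusChar p x‖ = 1 := by
  rw [torusChar, norm_prod]
  exact Finset.prod_eq_one fun k _ => Circle.norm_coe _

theorem torusChar_zero (x : Torus ν) : torusChar 0 x = 1 := by simp [torusChar]

theorem torusChar_add (p q : Fin ν → ℤ) (x : Torus ν) :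
    torusChar (p + q) x = torusChar p x * torusChar q x := by
  simp [torusChar, Finset.prod_mul_distrib]

theorem torusChar_neg (p : Fin ν → ℤ) (x : Torus ν) : torusChar (-p) x = conj (torusChar p x) := by
  simp [torusChar, map_prod]

theorem torusChar_sub (p q : Fin ν → ℤ) (x : Torus ν) :
    torusChar (p - q) x = torusChar p x * conj (torusChar q x) := by
  rw [sub_eq_add_neg, torusChar_add, torusChar_neg]

theorem torusChar_apply_neg (p : Fin ν → ℤ) (x : Torus ν) :
    torusChar p (-x) = conj (torusChar p x) := by
  rw [torusChar, torusChar, map_prod]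
  refine Finset.prod_congr rfl fun k _ => ?_
  rw [← fourier_neg, fourier_apply, fourier_apply, Pi.neg_apply, smul_neg, neg_smul]

theorem integrable_torusChar_mul {μ : Measure (Torus ν)} {g : Torus ν → ℂ} (hg : Integrable g μ)
    (p : Fin ν → ℤ) : Integrable (fun x => torusChar p x * g x) μ :=
  hg.bdd_mul (continuous_torusChar p).aestronglyMeasurable
    (Filter.Eventually.of_forall fun x => (norm_torusChar p x).le)

theorem torusFourier_withDensityᵥ {μ : Measure (Torus ν)} {g : Torus ν → ℂ} (hg : Integrable g μ)
    (p : Fin ν → ℤ) : torusFourier (μ.withDensityᵥ g) p = ∫ x, torusChar p x * g x ∂μ :=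
  integral_withDensityᵥ hg (continuous_torusChar p).stronglyMeasurable
    fun x => (norm_torusChar p x).le

theorem integrable_torusChar (G : ComplexMeasure (Torus ν)) (p : Fin ν → ℤ) :
    VectorMeasure.Integrable G (torusChar p) :=
  Integrable.of_bound (continuous_torusChar p).aestronglyMeasurable 1
    (Filter.Eventually.of_forall fun x => (norm_torusChar p x).le)

theorem torusFourier_add (G H : ComplexMeasure (Torus ν)) (p : Fin ν → ℤ) :
    torusFourier (G + H) p = torusFourier G p + torusFourier H p :=
  VectorMeasure.integral_add_vectorMeasure (integrable_torusChar G p) (integrable_torusChar H p)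

theorem torusFourier_sub (G H : ComplexMeasure (Torus ν)) (p : Fin ν → ℤ) :
    torusFourier (G - H) p = torusFourier G p - torusFourier H p :=
  VectorMeasure.integral_sub_vectorMeasure (integrable_torusChar G p) (integrable_torusChar H p)

theorem torusFourier_smul (c : ℂ) (G : ComplexMeasure (Torus ν)) (p : Fin ν → ℤ) :
    torusFourier (c • G) p = c * torusFourier G p := by
  obtain ⟨μ, g, -, hg, rfl⟩ := G.exists_eq_withDensityᵥ
  rw [← withDensityᵥ_smul, torusFourier_withDensityᵥ (hg.smul c), torusFourier_withDensityᵥ hg,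
    ← integral_const_mul]
  simp only [Pi.smul_apply, smul_eq_mul, mul_left_comm]

theorem torusFourier_conjugate (G : ComplexMeasure (Torus ν)) (p : Fin ν → ℤ) :
    torusFourier G.conjugate p = conj (torusFourier G (-p)) := by
  obtain ⟨μ, g, -, hg, rfl⟩ := G.exists_eq_withDensityᵥ
  rw [ComplexMeasure.conjugate_withDensityᵥ hg, torusFourier_withDensityᵥ,
    torusFourier_withDensityᵥ hg, ← integral_conj]
  · simp [torusChar_neg]
  · exact (LinearIsometryEquiv.integrable_comp_iff Complex.conjLIE).2 hg

theorem torusFourier_map_neg (G : ComplexMeasure (Torus ν)) (p : Fin ν → ℤ) :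
    torusFourier (G.map Neg.neg) p = torusFourier G (-p) := by
  unfold torusFourier
  have h : ∀ x : Torus ν, torusChar (-p) x = torusChar p (-x) := fun x => by
    rw [torusChar_neg, torusChar_apply_neg]
  rw [funext h]
  exact VectorMeasure.integral_map measurable_neg (continuous_torusChar p).aestronglyMeasurable
    (by rw [Function.comp_def, ← funext h]; exact integrable_torusChar G (-p))

/-- Stone–Weierstrass: the characters are closed under products and conjugation, so their span is a
star subalgebra, and the coordinate characters separate points. -/
theorem span_torusChar_dense :
    (Submodule.span ℂ (Set.range fun p : Fin ν → ℤ =>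
      (⟨torusChar p, continuous_torusChar p⟩ : C(Torus ν, ℂ)))).topologicalClosure = ⊤ := by
  classical
  set e : (Fin ν → ℤ) → C(Torus ν, ℂ) := fun p => ⟨torusChar p, continuous_torusChar p⟩ with he
  let A : StarSubalgebra ℂ C(Torus ν, ℂ) :=
    { toSubalgebra := Algebra.adjoin ℂ (Set.range e)
      star_mem' := by
        change Algebra.adjoin ℂ (Set.range e) ≤ star (Algebra.adjoin ℂ (Set.range e))
        refine Algebra.adjoin_le ?_
        rintro _ ⟨n, rfl⟩
        refine Algebra.subset_adjoin ⟨-n, ?_⟩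
        ext x
        simp [he, torusChar_neg] }
  have hspan : A.toSubalgebra.toSubmodule = Submodule.span ℂ (Set.range e) := by
    refine Algebra.adjoin_eq_span_of_subset ℂ (Set.Subset.trans (fun x hx => ?_)
      Submodule.subset_span)
    refine Submonoid.closure_induction (fun _ => id) ⟨0, ?_⟩ ?_ hx
    · ext x; simp [he, torusChar_zero]
    · rintro _ _ _ _ ⟨m, rfl⟩ ⟨n, rfl⟩
      exact ⟨m + n, by ext x; simp [he, torusChar_add]⟩
  have hsep : A.SeparatesPoints := by
    intro x y hxy
    obtain ⟨i, hi⟩ := Function.ne_iff.1 hxy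
    refine ⟨_, ⟨e (Pi.single i 1), Algebra.subset_adjoin ⟨Pi.single i 1, rfl⟩, rfl⟩, ?_⟩
    have key : ∀ z : Torus ν, e (Pi.single i 1) z = (AddCircle.toCircle (z i) : ℂ) := fun z => by
      change ∏ k, fourier ((Pi.single i (1 : ℤ) : Fin ν → ℤ) k) (z k) = _
      rw [Finset.prod_eq_single i (fun j _ hj => by rw [Pi.single_eq_of_ne hj, fourier_zero])
        (fun h => absurd (Finset.mem_univ i) h), Pi.single_eq_same, fourier_one]
    dsimp only
    change e _ x ≠ e _ y
    rw [key, key]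
    exact fun h => hi (AddCircle.injective_toCircle Real.two_pi_pos.ne' (Circle.ext h))
  have := ContinuousMap.starSubalgebra_topologicalClosure_eq_top_of_separatesPoints A hsep
  rw [← hspan]
  exact congr_arg (Subalgebra.toSubmodule <| StarSubalgebra.toSubalgebra ·) this

/-- With `H = g μ`, the functional `f ↦ ∫ f g dμ` is continuous and kills the characters, hence all
continuous functions; it remains to see that `g` vanishes almost everywhere. -/
theorem eq_zero_of_torusFourier_eq_zero (H : ComplexMeasure (Torus ν))
    (h : ∀ p, torusFourier H p = 0) : H = 0 := by
  obtain ⟨μ, g, hμ, hg, rfl⟩ := H.exists_eq_withDensityᵥ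
  have hcont : ∀ f : C(Torus ν, ℂ), ∫ x, f x * g x ∂μ = 0 := by
    have hfi : ∀ f : C(Torus ν, ℂ), Integrable (fun x => f x * g x) μ := fun f =>
      hg.bdd_mul f.continuous.aestronglyMeasurable (Filter.Eventually.of_forall f.norm_coe_le_norm)
    let T : C(Torus ν, ℂ) →ₗ[ℂ] ℂ :=
      { toFun f := ∫ x, f x * g x ∂μ
        map_add' f₁ f₂ := by
          rw [← integral_add (hfi f₁) (hfi f₂)]; simp [add_mul]
        map_smul' c f := by
          simp [mul_assoc, integral_const_mul] }
    let T' : C(Torus ν, ℂ) →L[ℂ] ℂ := T.mkContinuous (∫ x, ‖g x‖ ∂μ) fun f => by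
      rw [mul_comm (integral _ _), ← integral_const_mul]
      refine norm_integral_le_of_norm_le (hg.norm.const_mul _)
        (Filter.Eventually.of_forall fun x => ?_)
      rw [norm_mul]
      exact mul_le_mul_of_nonneg_right (f.norm_coe_le_norm x) (norm_nonneg _)
    have hle : (Submodule.span ℂ (Set.range fun p : Fin ν → ℤ =>
        (⟨torusChar p, continuous_torusChar p⟩ : C(Torus ν, ℂ)))).topologicalClosure
        ≤ T'.ker := by
      refine Submodule.topologicalClosure_minimal _ (Submodule.span_le.2 ?_) T'.isClosed_ker
      rintro _ ⟨p, rfl⟩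
      have := h p
      rw [torusFourier_withDensityᵥ hg] at this
      exact this
    rw [span_torusChar_dense] at hle
    exact fun f => hle Submodule.mem_top
  -- For real `k` the positive and negative parts of `k μ` are finite measures with equal integrals
  -- of continuous functions, so they coincide.
  have hreal : ∀ k : Torus ν → ℝ, Integrable k μ →
      (∀ f : C(Torus ν, ℝ), ∫ x, f x * k x ∂μ = 0) → k =ᵐ[μ] 0 := by
    intro k hk hf
    have e := withDensityᵥ_eq_withDensity_pos_part_sub_withDensity_neg_part hk
    have f1 := isFiniteMeasure_withDensity_ofReal hk.2
    have f2 := isFiniteMeasure_withDensity_ofReal hk.neg.2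
    have hint : ∀ (f : C(Torus ν, ℝ)), Integrable (fun x => f x * k x) μ := fun f =>
      hk.bdd_mul f.continuous.aestronglyMeasurable (Filter.Eventually.of_forall f.norm_coe_le_norm)
    have hpos : ∀ k' : Torus ν → ℝ, Integrable k' μ → ∀ f : C(Torus ν, ℝ),
        ∫ x, f x ∂(μ.withDensity fun x => ENNReal.ofReal (k' x)) = ∫ x, f x * max (k' x) 0 ∂μ := by
      intro k' hk' f
      rw [integral_withDensity_eq_integral_toReal_smul₀ hk'.aemeasurable.ennreal_ofReal
        (Filter.Eventually.of_forall fun x => ENNReal.ofReal_lt_top)]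
      simp [ENNReal.toReal_ofReal', mul_comm]
    have heq : (μ.withDensity fun x => ENNReal.ofReal (k x)) =
        μ.withDensity fun x => ENNReal.ofReal (-k x) := by
      have : IsFiniteMeasure (μ.withDensity fun x => ENNReal.ofReal (-k x)) := f2
      refine ext_of_forall_integral_eq_of_IsFiniteMeasure fun f => ?_
      have a := hpos k hk f.toContinuousMap
      have b := hpos (-k) hk.neg f.toContinuousMap
      have hb : ∀ k' : Torus ν → ℝ, Integrable k' μ →
          Integrable (fun x => f.toContinuousMap x * max (k' x) 0) μ := fun k' hk' =>
        hk'.pos_part.bdd_mul f.continuous.aestronglyMeasurable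
          (Filter.Eventually.of_forall f.norm_coe_le_norm)
      refine a.trans (Eq.trans ?_ b.symm)
      rw [← sub_eq_zero, ← integral_sub (hb k hk) (hb (-k) hk.neg)]
      refine Eq.trans ?_ (hf f.toContinuousMap)
      refine integral_congr_ae (Filter.Eventually.of_forall fun x => ?_)
      simp only [Pi.neg_apply, ← mul_sub]
      congr 1
      exact max_zero_sub_max_neg_zero_eq_self (k x)
    have h0 : μ.withDensityᵥ k = 0 := by
      rw [e]
      simp only [heq, sub_self]
    exact hk.ae_eq_of_withDensityᵥ_eq (integrable_zero _ _ _) (by rw [h0, withDensityᵥ_zero])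
  have hgr : (fun x => (g x).re) =ᵐ[μ] 0 := by
    refine hreal _ hg.re fun f => ?_
    have := congrArg Complex.re (hcont ⟨fun x => (f x : ℂ), by fun_prop⟩)
    rw [← RCLike.re_eq_complex_re, ← integral_re] at this
    · simpa using this
    · exact hg.bdd_mul (Continuous.aestronglyMeasurable (by fun_prop))
        (Filter.Eventually.of_forall (ContinuousMap.norm_coe_le_norm _))
  have hgi : (fun x => (g x).im) =ᵐ[μ] 0 := by
    refine hreal _ hg.im fun f => ?_
    have := congrArg Complex.im (hcont ⟨fun x => (f x : ℂ), by fun_prop⟩)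
    rw [← RCLike.im_eq_complex_im, ← integral_im] at this
    · simpa using this
    · exact hg.bdd_mul (Continuous.aestronglyMeasurable (by fun_prop))
        (Filter.Eventually.of_forall (ContinuousMap.norm_coe_le_norm _))
  have hg0 : g =ᵐ[μ] 0 := by
    filter_upwards [hgr, hgi] with x h1 h2
    exact Complex.ext h1 h2
  rw [WithDensityᵥEq.congr_ae hg0, withDensityᵥ_zero]

theorem torusFourier_injective {G H : ComplexMeasure (Torus ν)}
    (h : ∀ p, torusFourier G p = torusFourier H p) : G = H := by
  rw [← sub_eq_zero]
  exact eq_zero_of_torusFourier_eq_zero _ fun p => by rw [torusFourier_sub, h, sub_self]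

end Fourier
/-! ### Herglotz's theorem on the torus -/

section Herglotz

variable {ν : ℕ}

/-- The normalized Haar measure of the torus. -/
noncomputable def torusHaar (ν : ℕ) : Measure (Torus ν) :=
  Measure.pi fun _ => AddCircle.haarAddCircle

instance : IsProbabilityMeasure (torusHaar ν) := by unfold torusHaar; infer_instance

theorem integral_torusChar_torusHaar (p : Fin ν → ℤ) :
    ∫ x, torusChar p x ∂torusHaar ν = if p = 0 then 1 else 0 := by
  split_ifs with h
  · simp [h, torusChar_zero]
  · obtain ⟨k, hk⟩ := Function.ne_iff.1 h
    unfold torusChar torusHaar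
    rw [integral_fintype_prod_eq_prod (fun k (y : AddCircle (2 * Real.pi)) => fourier (p k) y)]
    -- Translation by half a period of the `k`-th factor changes its sign, so its integral is zero.
    exact Finset.prod_eq_zero (Finset.mem_univ k)
      (integral_eq_zero_of_add_right_eq_neg (fourier_add_half_inv_index hk Real.two_pi_pos))

/-- The box `{0, …, N - 1}^ν`. -/
noncomputable def latticeBox (ν N : ℕ) : Finset (Fin ν → ℤ) := Fintype.piFinset fun _ => Finset.Ico (0 : ℤ) N

theorem card_latticeBox (N : ℕ) : (latticeBox ν N).card = N ^ ν := by
  simp [latticeBox, Fintype.card_piFinset]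

/-- The box meets its translate in a box with sides `N - |n k|`, empty when some side is not
positive. -/
theorem card_latticeBox_inter_shift (N : ℕ) (n : Fin ν → ℤ) :
    ((latticeBox ν N).filter fun p => n + p ∈ latticeBox ν N).card
      = ∏ k, ((N : ℤ) - |n k|).toNat := by
  have : ((latticeBox ν N).filter fun p => n + p ∈ latticeBox ν N) =
      Fintype.piFinset fun k => Finset.Ico (max 0 (-n k)) (min (N : ℤ) (N - n k)) := by
    ext p
    simp only [latticeBox, Finset.mem_filter, Fintype.mem_piFinset, Finset.mem_Ico, Pi.add_apply,
      ← forall_and]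
    refine forall_congr' fun k => ?_
    omega
  rw [this, Fintype.card_piFinset]
  refine Finset.prod_congr rfl fun k _ => ?_
  rw [Int.card_Ico]
  congr 1
  rcases abs_cases (n k) with h | h <;> omega

theorem tendsto_card_latticeBox_inter_shift_div (n : Fin ν → ℤ) :
    Filter.Tendsto (fun N : ℕ => (((latticeBox ν N).filter fun p => n + p ∈ latticeBox ν N).card
      : ℝ) / (latticeBox ν N).card) Filter.atTop (nhds 1) := by
  have h1 : ∀ k : Fin ν, Filter.Tendsto (fun N : ℕ => (((N : ℤ) - |n k|).toNat : ℝ) / N)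
      Filter.atTop (nhds 1) := by
    intro k
    have h2 : Filter.Tendsto (fun N : ℕ => 1 - ((|n k| : ℤ) : ℝ) / N) Filter.atTop
        (nhds (1 - 0)) := tendsto_const_nhds.sub (tendsto_const_div_atTop_nhds_zero_nat _)
    rw [sub_zero] at h2
    refine h2.congr' ?_
    -- From here on the truncation in `toNat` is inactive and `N ≠ 0`.
    filter_upwards [Filter.eventually_ge_atTop (|n k|.toNat + 1)] with N hN
    have hN0 : (N : ℝ) ≠ 0 := by
      have : 0 < N := by omega
      exact_mod_cast this.ne'
    have : (((N : ℤ) - |n k|).toNat : ℝ) = N - ((|n k| : ℤ) : ℝ) := by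
      have : (((N : ℤ) - |n k|).toNat : ℤ) = N - |n k| := Int.toNat_of_nonneg (by omega)
      exact_mod_cast this
    rw [this]
    field_simp
  have h3 := tendsto_finsetProd Finset.univ fun k _ => h1 k
  rw [Finset.prod_const_one] at h3
  refine h3.congr fun N => ?_
  rw [card_latticeBox_inter_shift, card_latticeBox, Finset.prod_div_distrib]
  push_cast
  simp

variable {H : Type*} [NormedAddCommGroup H] [InnerProductSpace ℂ H]

/-- The Fejér density of a stationary sequence of vectors. -/
noncomputable def fejerDensity (v : (Fin ν → ℤ) → H) (N : ℕ) (x : Torus ν) : ℝ :=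
  ‖∑ p ∈ latticeBox ν N, torusChar (-p) x • v p‖ ^ 2 / (latticeBox ν N).card

theorem continuous_fejerDensity (v : (Fin ν → ℤ) → H) (N : ℕ) :
    Continuous (fejerDensity v N) := by
  unfold fejerDensity
  have := fun p : Fin ν → ℤ => continuous_torusChar (-p)
  fun_prop

theorem fejerDensity_nonneg (v : (Fin ν → ℤ) → H) (N : ℕ) (x : Torus ν) :
    0 ≤ fejerDensity v N x := by
  unfold fejerDensity; positivity

theorem integrable_fejerDensity (v : (Fin ν → ℤ) → H) (N : ℕ) :
    Integrable (fejerDensity v N) (torusHaar ν) := by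
  obtain ⟨C, hC⟩ := isCompact_univ.exists_bound_of_continuousOn
    (continuous_fejerDensity v N).continuousOn
  exact Integrable.of_bound (continuous_fejerDensity v N).aestronglyMeasurable C
    (Filter.Eventually.of_forall fun x => hC x trivial)

/-- Expanding the square gives terms `r (q - p) * torusChar (n + p - q)`. Orthogonality keeps only
`q = n + p`, each contributing `r n`, so one counts the `p` for which both points lie in the box. -/
theorem integral_torusChar_mul_fejerDensity (v : (Fin ν → ℤ) → H) (r : (Fin ν → ℤ) → ℂ)
    (hv : ∀ p q, inner ℂ (v p) (v q) = r (q - p)) (N : ℕ) (n : Fin ν → ℤ) :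
    ∫ x, torusChar n x * (fejerDensity v N x : ℂ) ∂torusHaar ν =
      r n * (((((latticeBox ν N).filter fun p => n + p ∈ latticeBox ν N).card
        : ℝ) / (latticeBox ν N).card : ℝ) : ℂ) := by
  have hF : ∀ x, torusChar n x * (fejerDensity v N x : ℂ) =
      (∑ p ∈ latticeBox ν N, ∑ q ∈ latticeBox ν N,
        r (q - p) * torusChar (n + p - q) x) / (latticeBox ν N).card := by
    intro x
    have h1 : ((‖∑ p ∈ latticeBox ν N, torusChar (-p) x • v p‖ ^ 2 : ℝ) : ℂ) =
        ∑ p ∈ latticeBox ν N, ∑ q ∈ latticeBox ν N,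
          torusChar p x * (torusChar (-q) x * r (q - p)) := by
      have := inner_self_eq_norm_sq_to_K (𝕜 := ℂ) (∑ p ∈ latticeBox ν N, torusChar (-p) x • v p)
      push_cast
      refine Eq.trans this.symm ?_
      rw [sum_inner]
      refine Finset.sum_congr rfl fun p _ => ?_
      rw [inner_sum]
      refine Finset.sum_congr rfl fun q _ => ?_
      rw [inner_smul_left, inner_smul_right, hv, torusChar_neg, Complex.conj_conj]
    rw [fejerDensity, Complex.ofReal_div, h1, Complex.ofReal_natCast, mul_div_assoc', Finset.mul_sum]
    congr 1
    refine Finset.sum_congr rfl fun p _ => ?_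
    rw [Finset.mul_sum]
    refine Finset.sum_congr rfl fun q _ => ?_
    rw [sub_eq_add_neg (n + p), torusChar_add, torusChar_add]
    ring
  simp only [hF]
  have hint : ∀ p q, Integrable (fun x => r (q - p) * torusChar (n + p - q) x) (torusHaar ν) :=
    fun p q => Integrable.const_mul (Integrable.of_bound
      (continuous_torusChar _).aestronglyMeasurable 1
      (Filter.Eventually.of_forall fun x => (norm_torusChar _ x).le)) _
  rw [integral_div, integral_finsetSum _ fun p _ => integrable_finsetSum _ fun q _ => hint p q]
  have hin : ∀ p, ∫ x, ∑ q ∈ latticeBox ν N, r (q - p) * torusChar (n + p - q) x ∂torusHaar ν =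
      if n + p ∈ latticeBox ν N then r n else 0 := by
    intro p
    rw [integral_finsetSum _ fun q _ => hint p q]
    simp_rw [integral_const_mul, integral_torusChar_torusHaar, sub_eq_zero]
    simp
  simp_rw [hin]
  rw [← Finset.sum_filter, Finset.sum_const, nsmul_eq_mul]
  push_cast
  ring

/-- **Herglotz's theorem**: the covariance function of a stationary family of vectors in an inner
product space is the Fourier transform of a finite measure. -/
theorem exists_isFiniteMeasure_integral_torusChar_eq (v : (Fin ν → ℤ) → H) (r : (Fin ν → ℤ) → ℂ)
    (hv : ∀ p q, inner ℂ (v p) (v q) = r (q - p)) :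
    ∃ μ : Measure (Torus ν), IsFiniteMeasure μ ∧ ∀ n, ∫ x, torusChar n x ∂μ = r n := by
  let m : ℕ → Measure (Torus ν) := fun N =>
    (torusHaar ν).withDensity fun x => ENNReal.ofReal (fejerDensity v N x)
  have hm : ∀ N, IsFiniteMeasure (m N) := fun N =>
    isFiniteMeasure_withDensity_ofReal (integrable_fejerDensity v N).2
  have hint : ∀ N n, ∫ x, torusChar n x ∂m N =
      r n * (((((latticeBox ν N).filter fun p => n + p ∈ latticeBox ν N).card
        : ℝ) / (latticeBox ν N).card : ℝ) : ℂ) := by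
    intro N n
    rw [← integral_torusChar_mul_fejerDensity v r hv,
      integral_withDensity_eq_integral_toReal_smul₀
        (integrable_fejerDensity v N).aemeasurable.ennreal_ofReal
        (Filter.Eventually.of_forall fun x => ENNReal.ofReal_lt_top)]
    refine integral_congr_ae (Filter.Eventually.of_forall fun x => ?_)
    simp [ENNReal.toReal_ofReal (fejerDensity_nonneg v N x), mul_comm]
  let M : ℕ → FiniteMeasure (Torus ν) := fun N => ⟨m N, hm N⟩
  -- The mass is the zeroth Fourier coefficient, `r 0 = ‖v 0‖²` times a ratio at most one.
  have hmass : ∀ N, (M N).mass ≤ ‖v 0‖₊ ^ 2 := by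
    intro N
    rw [← NNReal.coe_le_coe]
    have h0 := hint N 0
    simp only [torusChar_zero, integral_const, zero_add] at h0
    have hr0 : r 0 = ((‖v 0‖ ^ 2 : ℝ) : ℂ) := by
      rw [← sub_self (0 : Fin ν → ℤ), ← hv]
      have := inner_self_eq_norm_sq_to_K (𝕜 := ℂ) (v 0)
      push_cast
      exact this
    rw [hr0, ← Complex.ofReal_mul, Complex.real_smul, mul_one, Complex.ofReal_inj] at h0
    refine (h0.trans_le (mul_le_of_le_one_right (by positivity) ?_)).trans_eq (by simp)
    exact div_le_one_of_le₀ (by exact_mod_cast Finset.card_filter_le _ _) (by positivity)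
  -- Measures of bounded mass on a compact space are weakly compact; a limit along an ultrafilter
  -- replaces the choice of a subsequence.
  obtain ⟨μ, -, hμ⟩ := (isCompact_setOfPred_finiteMeasure_le_of_compactSpace (Torus ν)
    (‖v 0‖₊ ^ 2)).ultrafilter_le_nhds ((Filter.hyperfilter ℕ).map M)
      (Filter.le_principal_iff.2 (Filter.mem_map.2 (Filter.univ_mem' hmass)))
  have hμ' : Filter.Tendsto M (Filter.hyperfilter ℕ) (nhds μ) := hμ
  rw [FiniteMeasure.tendsto_iff_forall_integral_rclike_tendsto ℂ] at hμ'
  refine ⟨μ, inferInstance, fun n => ?_⟩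
  have h1 := hμ' (BoundedContinuousFunction.mkOfCompact ⟨torusChar n, continuous_torusChar n⟩)
  have h2 : Filter.Tendsto (fun N => r n *
      (((((latticeBox ν N).filter fun p => n + p ∈ latticeBox ν N).card
        : ℝ) / (latticeBox ν N).card : ℝ) : ℂ)) Filter.atTop (nhds (r n * ((1 : ℝ) : ℂ))) :=
    ((Complex.continuous_ofReal.tendsto 1).comp
      (tendsto_card_latticeBox_inter_shift_div n)).const_mul _
  rw [Complex.ofReal_one, mul_one] at h2
  refine tendsto_nhds_unique h1 ((h2.mono_left Nat.hyperfilter_le_atTop).congr fun N => ?_)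
  exact (hint N n).symm

end Herglotz
/-! ### Spectral matrix measures of stationary families of vectors -/

section HilbertSpectral

variable {ν d : ℕ} {H : Type*} [NormedAddCommGroup H] [InnerProductSpace ℂ H]

theorem exists_complexMeasure_torusFourier_inner_self (v : (Fin ν → ℤ) → H)
    (r : (Fin ν → ℤ) → ℂ) (hv : ∀ p q, inner ℂ (v p) (v q) = r (q - p)) :
    ∃ N : ComplexMeasure (Torus ν), (∀ s, 0 ≤ N s) ∧ ∀ n, torusFourier N n = r n := by
  obtain ⟨μ, hμ, h⟩ := exists_isFiniteMeasure_integral_torusChar_eq v r hv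
  have hi : Integrable (fun _ : Torus ν => (1 : ℂ)) μ := integrable_const 1
  refine ⟨μ.withDensityᵥ fun _ => 1, fun s => ?_, fun n => ?_⟩
  · by_cases hs : MeasurableSet s
    · rw [withDensityᵥ_apply hi hs, setIntegral_const, Complex.real_smul, mul_one]
      exact Complex.zero_le_real.2 measureReal_nonneg
    · rw [VectorMeasure.not_measurable _ hs]
  · rw [torusFourier_withDensityᵥ hi, ← h]
    simp

/-- Polarization: the spectral measures of `u + a • v` for `a = 1, -1, I, -I` are combined so that
`f`, `g` and `r'` cancel and `r` appears four times. -/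
theorem exists_complexMeasure_torusFourier_inner (u v : (Fin ν → ℤ) → H)
    (f g r r' : (Fin ν → ℤ) → ℂ) (huu : ∀ p q, inner ℂ (u p) (u q) = f (q - p))
    (hvv : ∀ p q, inner ℂ (v p) (v q) = g (q - p)) (huv : ∀ p q, inner ℂ (u p) (v q) = r (q - p))
    (hvu : ∀ p q, inner ℂ (v p) (u q) = r' (q - p)) :
    ∃ G : ComplexMeasure (Torus ν), ∀ n, torusFourier G n = r n := by
  have key : ∀ a : ℂ, ∃ N : ComplexMeasure (Torus ν), ∀ n, torusFourier N n =
      f n + a * r n + conj a * r' n + conj a * a * g n := fun a => by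
    obtain ⟨N, -, hN⟩ := exists_complexMeasure_torusFourier_inner_self (fun p => u p + a • v p)
      (fun n => f n + a * r n + conj a * r' n + conj a * a * g n) fun p q => by
        simp only [inner_add_left, inner_add_right, inner_smul_left, inner_smul_right, huu, hvv,
          huv, hvu]
        ring
    exact ⟨N, hN⟩
  choose N hN using key
  refine ⟨(1 / 4 : ℂ) • (N 1 - N (-1) - Complex.I • N Complex.I + Complex.I • N (-Complex.I)),
    fun n => ?_⟩
  simp only [torusFourier_smul, torusFourier_add, torusFourier_sub, hN, map_one, map_neg,
    Complex.conj_I]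
  ring_nf
  simp only [Complex.I_sq]
  ring

variable (v : Fin d → (Fin ν → ℤ) → H) (r : Fin d → Fin d → (Fin ν → ℤ) → ℂ)

theorem exists_matrixMeasure_torusFourier
    (hv : ∀ j j' p q, inner ℂ (v j p) (v j' q) = r j j' (q - p)) :
    ∃ G : MatrixMeasure ν d, ∀ j j' n, torusFourier (G j j') n = r j j' n := by
  choose G hG using fun j j' => exists_complexMeasure_torusFourier_inner (v j) (v j') (r j j)
    (r j' j') (r j j') (r j' j) (hv j j) (hv j' j') (hv j j') (hv j' j)
  exact ⟨G, hG⟩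

variable {v r} {G : MatrixMeasure ν d}

theorem matrixMeasure_eq_conjugate
    (hv : ∀ j j' p q, inner ℂ (v j p) (v j' q) = r j j' (q - p))
    (hG : ∀ j j' n, torusFourier (G j j') n = r j j' n) (j j' : Fin d) :
    G j' j = (G j j').conjugate := by
  refine torusFourier_injective fun p => ?_
  rw [torusFourier_conjugate, hG, hG]
  have h1 := hv j' j 0 p
  have h2 := hv j j' p 0
  rw [sub_zero] at h1
  rw [zero_sub] at h2
  rw [← h1, ← h2, inner_conj_symm]

theorem matrixMeasure_isHermitian
    (hv : ∀ j j' p q, inner ℂ (v j p) (v j' q) = r j j' (q - p))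
    (hG : ∀ j j' n, torusFourier (G j j') n = r j j' n) : G.IsHermitian := fun j j' A _ => by
  rw [matrixMeasure_eq_conjugate hv hG j j', ComplexMeasure.conjugate_apply]

/-- Reflection replaces `p` by `-p` in the transform, and conjugation of the measure does so while
also conjugating the value; for real `r` the two agree. -/
theorem matrixMeasure_isEven (hr : ∀ j j' p, conj (r j j' p) = r j j' p)
    (hG : ∀ j j' n, torusFourier (G j j') n = r j j' n) : G.IsEven := fun j j' A hA => by
  have : (G j j').map Neg.neg = (G j j').conjugate := torusFourier_injective fun p => by
    rw [torusFourier_map_neg, torusFourier_conjugate, hG, hr]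
  rw [← ComplexMeasure.conjugate_apply, ← this, VectorMeasure.map_apply _ measurable_neg hA]
  rfl

theorem exists_isDominatedBy (G : MatrixMeasure ν d) :
    ∃ μ : Measure (Torus ν), IsFiniteMeasure μ ∧ G.IsDominatedBy μ := by
  refine ⟨∑ j, ∑ j', (G j j').dominating, inferInstance, fun j j' =>
    ComplexMeasure.absolutelyContinuous_of_dominating_le _ fun s => ?_⟩
  simp only [Measure.coe_finsetSum, Finset.sum_apply]
  exact (Finset.single_le_sum (f := fun k => (G j k).dominating s) (fun _ _ => zero_le)
    (Finset.mem_univ j')).trans (Finset.single_le_sum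
    (f := fun i => ∑ k, (G i k).dominating s) (fun _ _ => zero_le) (Finset.mem_univ j))

theorem ae_nonneg_of_forall_withDensityᵥ_nonneg {α : Type*} [MeasurableSpace α] {μ : Measure α}
    {h : α → ℂ} (hh : Integrable h μ) (h0 : ∀ s, 0 ≤ μ.withDensityᵥ h s) : ∀ᵐ x ∂μ, 0 ≤ h x := by
  have hre : 0 ≤ᵐ[μ] fun x => (h x).re :=
    ae_nonneg_of_forall_setIntegral_nonneg hh.re fun s hs _ => by
      have := (Complex.le_def.1 (h0 s)).1
      rwa [withDensityᵥ_apply hh hs, ← RCLike.re_eq_complex_re, ← integral_re hh.integrableOn,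
        map_zero] at this
  have him : (fun x => (h x).im) =ᵐ[μ] 0 :=
    Integrable.ae_eq_zero_of_forall_setIntegral_eq_zero hh.im fun s hs _ => by
      have := (Complex.le_def.1 (h0 s)).2.symm
      rwa [withDensityᵥ_apply hh hs, ← RCLike.im_eq_complex_im, ← integral_im hh.integrableOn,
        map_zero] at this
  filter_upwards [hre, him] with x h1 h2
  exact Complex.le_def.2 ⟨h1, h2.symm⟩

/-- For each fixed `c` the quadratic form of the density is nonnegative off a null set depending on
`c`. A dense sequence of `c` leaves one null set, and continuity in `c` covers the rest. -/
theorem ae_posSemidef_density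
    (hv : ∀ j j' p q, inner ℂ (v j p) (v j' q) = r j j' (q - p))
    (hG : ∀ j j' n, torusFourier (G j j') n = r j j' n)
    (μ : Measure (Torus ν)) [IsFiniteMeasure μ] (hμ : G.IsDominatedBy μ) :
    ∀ᵐ x ∂μ, (G.density μ x).PosSemidef := by
  have hD : ∀ j j', μ.withDensityᵥ (ComplexMeasure.rnDeriv (G j j') μ) = G j j' := fun j j' =>
    ComplexMeasure.withDensityᵥ_rnDeriv_eq _ μ (hμ j j')
  have hI : ∀ j j', Integrable (ComplexMeasure.rnDeriv (G j j') μ) μ := fun j j' =>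
    ComplexMeasure.integrable_rnDeriv _ μ
  have hherm : ∀ᵐ x ∂μ, ∀ j j', ComplexMeasure.rnDeriv (G j' j) μ x =
      conj (ComplexMeasure.rnDeriv (G j j') μ x) := by
    rw [ae_all_iff]; intro j
    rw [ae_all_iff]; intro j'
    refine (hI j' j).ae_eq_of_withDensityᵥ_eq
      ((LinearIsometryEquiv.integrable_comp_iff Complex.conjLIE).2 (hI j j')) ?_
    refine Eq.trans ?_ (ComplexMeasure.conjugate_withDensityᵥ (hI j j'))
    rw [hD, hD, matrixMeasure_eq_conjugate hv hG j j']
  have hquad : ∀ c : Fin d → ℂ, ∀ᵐ x ∂μ,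
      0 ≤ ∑ j, ∑ j', conj (c j) * c j' * ComplexMeasure.rnDeriv (G j j') μ x := by
    intro c
    have hi : ∀ j j', Integrable
        (fun x => conj (c j) * c j' * ComplexMeasure.rnDeriv (G j j') μ x) μ :=
      fun j j' => (hI j j').const_mul _
    refine ae_nonneg_of_forall_withDensityᵥ_nonneg
      (integrable_finsetSum _ fun j _ => integrable_finsetSum _ fun j' _ => hi j j') ?_
    -- `N` is the nonnegative spectral measure of `p ↦ ∑ j, c j • v j p`; uniqueness identifies it
    -- with the combination of the `G j j'`.
    obtain ⟨N, hN0, hN⟩ := exists_complexMeasure_torusFourier_inner_self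
      (fun p => ∑ j, c j • v j p) (fun n => ∑ j, ∑ j', conj (c j) * c j' * r j j' n) fun p q => by
        rw [sum_inner]
        refine Finset.sum_congr rfl fun j _ => ?_
        rw [inner_sum]
        refine Finset.sum_congr rfl fun j' _ => ?_
        rw [inner_smul_left, inner_smul_right, hv, mul_assoc]
    have hN' : μ.withDensityᵥ
        (fun x => ∑ j, ∑ j', conj (c j) * c j' * ComplexMeasure.rnDeriv (G j j') μ x) = N := by
      refine torusFourier_injective fun n => ?_
      rw [hN, torusFourier_withDensityᵥ
        (integrable_finsetSum _ fun j _ => integrable_finsetSum _ fun j' _ => hi j j')]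
      simp_rw [Finset.mul_sum]
      rw [integral_finsetSum _ fun j _ => integrable_finsetSum _ fun j' _ =>
        integrable_torusChar_mul (hi j j') n]
      refine Finset.sum_congr rfl fun j _ => ?_
      rw [integral_finsetSum _ fun j' _ => integrable_torusChar_mul (hi j j') n]
      refine Finset.sum_congr rfl fun j' _ => ?_
      rw [← hG, ← hD j j', torusFourier_withDensityᵥ (hI j j'), hD j j', ← integral_const_mul]
      simp only [mul_left_comm]
    rw [hN']
    exact hN0
  have hdense : ∀ᵐ x ∂μ, ∀ n : ℕ, 0 ≤ ∑ j, ∑ j',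
      conj (TopologicalSpace.denseSeq (Fin d → ℂ) n j) *
        TopologicalSpace.denseSeq (Fin d → ℂ) n j' * ComplexMeasure.rnDeriv (G j j') μ x :=
    ae_all_iff.2 fun n => hquad _
  filter_upwards [hherm, hdense] with x h1 h2
  refine Matrix.PosSemidef.of_dotProduct_mulVec_nonneg ?_ fun c => ?_
  · ext j j'
    exact (h1 j' j).symm
  · have hcl : IsClosed {c : Fin d → ℂ | 0 ≤ ∑ j, ∑ j',
        conj (c j) * c j' * ComplexMeasure.rnDeriv (G j j') μ x} :=
      isClosed_le continuous_const (by fun_prop)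
    have hc : c ∈ {c : Fin d → ℂ | 0 ≤ ∑ j, ∑ j',
        conj (c j) * c j' * ComplexMeasure.rnDeriv (G j j') μ x} :=
      hcl.closure_subset_iff.2 (Set.range_subset_iff.2 h2)
        ((TopologicalSpace.denseRange_denseSeq (Fin d → ℂ)) c)
    refine (Set.mem_ofPred_eq ▸ hc).trans_eq ?_
    simp only [dotProduct, Matrix.mulVec, Finset.mul_sum]
    refine Finset.sum_congr rfl fun j _ => Finset.sum_congr rfl fun j' _ => ?_
    rw [MatrixMeasure.density, Matrix.of_apply, Pi.star_apply, mul_assoc, mul_comm (c j')]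
    rfl

end HilbertSpectral

/-! ### The spectral representation of a stationary field -/

namespace RandomField

variable {ν d : ℕ} {Ω : Type*} [MeasurableSpace Ω] {P : Measure Ω} {X : RandomField ν d Ω}

theorem mixedMoment_shift (hX : X.IsStationary P) (j j' : Fin d) (p q m : Fin ν → ℤ) :
    X.mixedMoment P j j' (p + m) (q + m) = X.mixedMoment P j j' p q := by
  classical
  have h := hX m {p, q}
  have hm : Measurable fun x : (({p, q} : Finset (Fin ν → ℤ)) → EuclideanSpace ℝ (Fin d)) =>
      x ⟨p, by simp⟩ j * x ⟨q, by simp⟩ j' := by fun_prop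
  exact (h.comp hm).integral_eq

theorem mixedMoment_eq_corr (hX : X.IsStationary P) (j j' : Fin d) (p q : Fin ν → ℤ) :
    X.mixedMoment P j j' p q = X.corr P j j' (q - p) := by
  have := mixedMoment_shift hX j j' 0 (q - p) p
  rwa [zero_add, sub_add_cancel] at this

theorem memLp_coord (hX : ∀ p, MemLp (X p) 2 P) (j : Fin d) (p : Fin ν → ℤ) :
    MemLp (fun ω => (X p ω j : ℂ)) 2 P :=
  ((EuclideanSpace.proj j : EuclideanSpace ℝ (Fin d) →L[ℝ] ℝ).comp_memLp' (hX p)).ofReal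

/-- The coordinates of a random field as vectors of the complex `L²` space. -/
noncomputable def toL2 (hX : ∀ p, MemLp (X p) 2 P) (j : Fin d) (p : Fin ν → ℤ) : Lp ℂ 2 P :=
  (memLp_coord hX j p).toLp _

theorem inner_toL2 (hX : ∀ p, MemLp (X p) 2 P) (j j' : Fin d) (p q : Fin ν → ℤ) :
    inner ℂ (toL2 hX j p) (toL2 hX j' q) = (X.mixedMoment P j j' p q : ℂ) := by
  rw [L2.inner_def, mixedMoment, ← integral_complex_ofReal]
  refine integral_congr_ae ?_
  filter_upwards [(memLp_coord hX j p).coeFn_toLp, (memLp_coord hX j' q).coeFn_toLp] with ω h1 h2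
  rw [toL2, toL2, h1, h2]
  simp [mul_comm]

theorem exists_spectral_measure (hX : ∀ p, MemLp (X p) 2 P) (hs : X.IsStationary P) :
    ∃ G : MatrixMeasure ν d,
      (∀ j j', HasFiniteTotalVariation (G j j')) ∧
      (∀ j j' p, (X.corr P j j' p : ℂ) = torusFourier (G j j') p ∧
        ∀ m, X.mixedMoment P j j' m (m + p) = X.corr P j j' p) ∧
      G.IsHermitian ∧ G.IsEven ∧
      (∀ j j' (H : ComplexMeasure (Torus ν)),
        (∀ p, (X.corr P j j' p : ℂ) = torusFourier H p) → H = G j j') ∧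
      (∃ μ : Measure (Torus ν), IsFiniteMeasure μ ∧ G.IsDominatedBy μ) ∧
      (∀ μ : Measure (Torus ν), IsFiniteMeasure μ → G.IsDominatedBy μ →
        ∀ᵐ x ∂μ, (G.density μ x).PosSemidef) := by
  have hv : ∀ j j' p q, inner ℂ (toL2 hX j p) (toL2 hX j' q) =
      (fun j j' n => (X.corr P j j' n : ℂ)) j j' (q - p) := fun j j' p q => by
    rw [inner_toL2, mixedMoment_eq_corr hs]
  obtain ⟨G, hG⟩ := exists_matrixMeasure_torusFourier (toL2 hX)
    (fun j j' n => (X.corr P j j' n : ℂ)) hv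
  refine ⟨G, fun j j' => hasFiniteTotalVariation_complexMeasure _,
    fun j j' p => ⟨(hG j j' p).symm, fun m => ?_⟩, matrixMeasure_isHermitian hv hG,
    matrixMeasure_isEven (fun j j' p => Complex.conj_ofReal _) hG, fun j j' H hH => ?_,
    exists_isDominatedBy G, fun μ _ hμ => ae_posSemidef_density hv hG μ hμ⟩
  · rw [mixedMoment_eq_corr hs, add_sub_cancel_left]
  · exact torusFourier_injective fun p => by rw [← hH p, hG]

end RandomField
/-! ### Gaussian processes with a prescribed covariance -/

section GaussianProcess

theorem integral_linear_mul_linear {Ω : Type*} [MeasurableSpace Ω] {P : Measure Ω} {ι : Type*}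
    {X : ι → Ω → ℝ} (hX : ∀ i, MemLp (X i) 2 P) (s t : Finset ι) (a b : ι → ℝ) :
    ∫ ω, (∑ i ∈ s, a i * X i ω) * (∑ j ∈ t, b j * X j ω) ∂P =
      ∑ i ∈ s, ∑ j ∈ t, a i * b j * ∫ ω, X i ω * X j ω ∂P := by
  have hint : ∀ i j, Integrable (fun ω => a i * b j * (X i ω * X j ω)) P := fun i j =>
    ((hX i).integrable_mul (hX j)).const_mul _
  have : ∀ ω, (∑ i ∈ s, a i * X i ω) * (∑ j ∈ t, b j * X j ω) =
      ∑ i ∈ s, ∑ j ∈ t, a i * b j * (X i ω * X j ω) := fun ω => by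
    rw [Finset.sum_mul_sum]
    exact Finset.sum_congr rfl fun i _ => Finset.sum_congr rfl fun j _ => by ring
  simp_rw [this]
  rw [integral_finsetSum _ fun i _ => integrable_finsetSum _ fun j _ => hint i j]
  refine Finset.sum_congr rfl fun i _ => ?_
  rw [integral_finsetSum _ fun j _ => hint i j]
  exact Finset.sum_congr rfl fun j _ => integral_const_mul _ _

/-- Centered Gaussian vectors with the same covariances have the same law. -/
theorem identDistrib_of_hasGaussianLaw {Ω : Type*} [MeasurableSpace Ω] {P : Measure Ω} {ι : Type*}
    [Fintype ι] {X X' : Ω → ι → ℝ} (hX : HasGaussianLaw X P) (hX' : HasGaussianLaw X' P)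
    (h0 : ∀ i, ∫ ω, X ω i ∂P = 0) (h0' : ∀ i, ∫ ω, X' ω i ∂P = 0)
    (hcov : ∀ i j, ∫ ω, X ω i * X ω j ∂P = ∫ ω, X' ω i * X' ω j ∂P) :
    IdentDistrib X X' P P := by
  classical
  have hP := hX.isProbabilityMeasure
  have hg := hX.isGaussian_map
  have hg' := hX'.isGaussian_map
  -- The Gaussian characteristic function at `L` involves only the mean and variance of `L X`, and
  -- these are computed from the coordinate moments.
  refine ⟨hX.aemeasurable, hX'.aemeasurable, Measure.ext_of_charFunDual ?_⟩
  ext L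
  have hL : ∀ x : ι → ℝ, L x = ∑ i, L (Pi.single i 1) * x i := fun x => by
    conv_lhs => rw [← Finset.univ_sum_single x, map_sum]
    refine Finset.sum_congr rfl fun i _ => ?_
    rw [mul_comm, ← smul_eq_mul, ← map_smul, ← Pi.single_smul, smul_eq_mul, mul_one]
  have hmem : ∀ {Z : Ω → ι → ℝ}, HasGaussianLaw Z P → ∀ i, MemLp (fun ω => Z ω i) 2 P :=
    fun hZ i => (hZ.map_fun (ContinuousLinearMap.proj i)).memLp_two
  have hmean : ∀ {Z : Ω → ι → ℝ}, HasGaussianLaw Z P → (∀ i, ∫ ω, Z ω i ∂P = 0) →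
      ∫ ω, L (Z ω) ∂P = 0 := fun {Z} hZ hz => by
    simp_rw [hL (Z _)]
    rw [integral_finsetSum _ fun i _ => ((hmem hZ i).integrable one_le_two).const_mul _]
    simp [integral_const_mul, hz]
  have hvar : ∀ {Z : Ω → ι → ℝ}, HasGaussianLaw Z P → (∀ i, ∫ ω, Z ω i ∂P = 0) →
      Var[fun ω => L (Z ω); P] = ∑ i, ∑ j, L (Pi.single i 1) * L (Pi.single j 1) *
        ∫ ω, Z ω i * Z ω j ∂P := fun {Z} hZ hz => by
    rw [variance_eq_sub (hZ.map_fun L).memLp_two, hmean hZ hz]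
    rw [← integral_linear_mul_linear (X := fun i ω => Z ω i) (hmem hZ)]
    simp only [Pi.pow_apply, hL (Z _), sq, mul_zero, sub_zero]
  rw [hX.charFunDual_map_eq_fun, hX'.charFunDual_map_eq_fun, hvar hX h0, hvar hX' h0']
  simp only [hmean hX h0, hmean hX' h0', hcov]

/-- Enumerate `S` and expand each vector in the Gram–Schmidt vectors `g k`, then replace `g k` by
`‖g k‖ * ξ k` with independent standard normals `ξ k`. Leaving `g k` unnormalized makes linear
dependence harmless. -/
theorem exists_isGaussianProcess_of_vectors {E S : Type*} [NormedAddCommGroup E]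
    [InnerProductSpace ℝ E] [Countable S] (u : S → E) :
    ∃ (Ω : Type) (_ : MeasurableSpace Ω) (P : Measure Ω) (_ : IsProbabilityMeasure P)
      (Y : S → Ω → ℝ), IsGaussianProcess Y P ∧ (∀ s, ∫ ω, Y s ω ∂P = 0) ∧
        ∀ s t, ∫ ω, Y s ω * Y t ω ∂P = inner ℝ (u s) (u t) := by
  classical
  obtain ⟨f, hf⟩ := exists_injective_nat S
  let v : ℕ → E := fun n => if h : ∃ s, f s = n then u h.choose else 0
  have hv : ∀ s, v (f s) = u s := fun s => by
    have h : ∃ t, f t = f s := ⟨s, rfl⟩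
    simp only [v, dif_pos h]
    exact congrArg u (hf h.choose_spec)
  let g : ℕ → E := InnerProductSpace.gramSchmidt ℝ v
  have hgram : ∀ n, ∃ b : ℕ → ℝ, v n = ∑ k ∈ Finset.range (n + 1), b k • g k := fun n => by
    -- `v n` is `g n` plus its projections on the earlier `g k`.
    refine ⟨fun k => if k = n then 1 else inner ℝ (g k) (v n) / ‖g k‖ ^ 2, ?_⟩
    have := InnerProductSpace.gramSchmidt_def'' ℝ v n
    beta_reduce
    rw [Finset.sum_range_succ, if_pos rfl, one_smul, add_comm]
    refine this.trans (congrArg₂ _ rfl ?_)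
    rw [Nat.Iio_eq_range]
    refine Finset.sum_congr rfl fun k hk => ?_
    rw [if_neg (Finset.mem_range.1 hk).ne]
    rfl
  choose b hb using hgram
  obtain ⟨Ω, mΩ, P, ξ, hξm, hξl, hξi, hP⟩ := exists_iid ℕ (gaussianReal 0 1)
  have hξG : IsGaussianProcess ξ P := ⟨fun I =>
    (hξi.precomp Subtype.val_injective).hasGaussianLaw fun i => (hξl i).hasGaussianLaw⟩
  have hξ2 : ∀ n, MemLp (ξ n) 2 P := fun n => (hξl n).hasGaussianLaw.memLp_two
  have hξ0 : ∀ n, ∫ ω, ξ n ω ∂P = 0 := fun n => by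
    rw [(hξl n).integral_eq, integral_id_gaussianReal]
  have hξc : ∀ m n, ∫ ω, ξ m ω * ξ n ω ∂P = if m = n then 1 else 0 := fun m n => by
    split_ifs with h
    · subst h
      have h1 : Var[ξ m; P] = 1 := by
        rw [(hξl m).variance_eq, variance_id_gaussianReal]; simp
      rw [variance_eq_sub (hξ2 m), hξ0] at h1
      simpa [sq] using h1
    · have := (hξi.indepFun h).integral_mul_eq_mul_integral (hξm m).aestronglyMeasurable
        (hξm n).aestronglyMeasurable
      rw [hξ0, zero_mul] at this
      exact this
  refine ⟨Ω, mΩ, P, hP,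
    fun s ω => ∑ k ∈ Finset.range (f s + 1), (b (f s) k * ‖g k‖) * ξ k ω, ?_, fun s => ?_,
    fun s t => ?_⟩
  · refine hξG.of_isGaussianProcess fun s => ⟨Finset.range (f s + 1),
      ∑ k : Finset.range (f s + 1), (b (f s) k * ‖g k‖) • ContinuousLinearMap.proj k, fun ω => ?_⟩
    rw [_root_.sum_apply, ← Finset.sum_coe_sort]
    rfl
  · rw [integral_finsetSum _ fun k _ => ((hξ2 k).integrable one_le_two).const_mul _]
    simp [integral_const_mul, hξ0]
  · rw [integral_linear_mul_linear hξ2, ← hv s, ← hv t, hb, hb (f t), sum_inner]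
    refine Finset.sum_congr rfl fun k _ => ?_
    rw [inner_sum]
    refine Finset.sum_congr rfl fun l _ => ?_
    rw [real_inner_smul_left, real_inner_smul_right, hξc]
    split_ifs with h
    · subst h
      rw [real_inner_self_eq_norm_sq]; ring
    · rw [InnerProductSpace.gramSchmidt_orthogonal ℝ v h]; ring

/-- Every positive semidefinite kernel on a countable set is the covariance of a centered Gaussian
process. -/
theorem exists_isGaussianProcess_of_kernel {S : Type*} [Countable S] (k : S → S → ℝ)
    (hsymm : ∀ s t, k s t = k t s)
    (hpos : ∀ c : S →₀ ℝ, 0 ≤ c.sum fun s a => c.sum fun t b => a * b * k s t) :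
    ∃ (Ω : Type) (_ : MeasurableSpace Ω) (P : Measure Ω) (_ : IsProbabilityMeasure P)
      (Y : S → Ω → ℝ), IsGaussianProcess Y P ∧ (∀ s, ∫ ω, Y s ω ∂P = 0) ∧
        ∀ s t, ∫ ω, Y s ω * Y t ω ∂P = k s t := by
  -- The scalar kernel is read as an operator-valued one on `ℝ`; its kernel functions at `1` are
  -- vectors with Gram matrix `k`.
  let K : Matrix S S (ℝ →L[ℝ] ℝ) := Matrix.of fun s t => k s t • (1 : ℝ →L[ℝ] ℝ)
  have hK : Fact K.PosSemidef := ⟨by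
    refine ((RKHS.posSemidef_tfae (K := K)).out 0 2 rfl rfl).2 (And.intro ?_ fun c => ?_)
    · ext s t
      simp [K, hsymm s t]
    · refine (hpos c).trans_eq ?_
      simp only [Finsupp.sum, RCLike.re_to_real]
      refine Finset.sum_congr rfl fun s _ => Finset.sum_congr rfl fun t _ => ?_
      simp only [K, Matrix.of_apply, FunLike.coe_smul, one_apply_eq_self,
        Pi.smul_apply, smul_eq_mul, hsymm t s, RCLike.inner_apply, conj_trivial]
      ring⟩
  obtain ⟨Ω, mΩ, P, hP, Y, h1, h2, h3⟩ := exists_isGaussianProcess_of_vectors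
    fun s => RKHS.kerFun (RKHS.OfKernel K) s (1 : ℝ)
  refine ⟨Ω, mΩ, P, hP, Y, h1, h2, fun s t => ?_⟩
  rw [h3, ← RKHS.kernel_inner, RKHS.OfKernel.kernel_ofKernel]
  simp [K, hsymm t s]

end GaussianProcess
/-! ### Gaussian fields with a prescribed spectral measure -/

namespace MatrixMeasure

variable {ν d : ℕ} {G : MatrixMeasure ν d}

theorem IsEven.conj_torusFourier (hG : G.IsEven) (j j' : Fin d) (p : Fin ν → ℤ) :
    conj (torusFourier (G j j') p) = torusFourier (G j j') p := by
  have h : (G j j').map Neg.neg = (G j j').conjugate := by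
    ext A hA
    rw [ComplexMeasure.conjugate_apply, ← hG j j' A hA, VectorMeasure.map_apply _ measurable_neg hA]
    rfl
  have := torusFourier_conjugate (G j j') (-p)
  rw [neg_neg, ← h, torusFourier_map_neg, neg_neg] at this
  exact this.symm

theorem IsEven.ofReal_re_torusFourier (hG : G.IsEven) (j j' : Fin d) (p : Fin ν → ℤ) :
    ((torusFourier (G j j') p).re : ℂ) = torusFourier (G j j') p :=
  Complex.conj_eq_iff_re.1 (hG.conj_torusFourier j j' p)

theorem IsDominatedBy.torusFourier_eq {μ : Measure (Torus ν)} [IsFiniteMeasure μ]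
    (h : G.IsDominatedBy μ) (j j' : Fin d) (p : Fin ν → ℤ) :
    torusFourier (G j j') p = ∫ x, torusChar p x * G.density μ x j j' ∂μ := by
  conv_lhs => rw [← ComplexMeasure.withDensityᵥ_rnDeriv_eq _ μ (h j j')]
  exact torusFourier_withDensityᵥ (ComplexMeasure.integrable_rnDeriv _ μ) p

theorem IsPosSemidef.torusFourier_swap (hG : G.IsPosSemidef) (j j' : Fin d) (p : Fin ν → ℤ) :
    torusFourier (G j' j) (-p) = conj (torusFourier (G j j') p) := by
  obtain ⟨μ, hμ, hdom, hpos⟩ := hG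
  rw [hdom.torusFourier_eq, hdom.torusFourier_eq, ← integral_conj]
  refine integral_congr_ae ?_
  filter_upwards [hpos] with x hx
  rw [torusChar_neg, map_mul, ← hx.isHermitian.apply j' j]
  rfl

/-- The sum is the real part of `∫ z* g z dμ`, where `g` is the density and `z` is `c` twisted by
the characters. -/
theorem IsPosSemidef.sum_nonneg (hG : G.IsPosSemidef) (c : Fin d × (Fin ν → ℤ) →₀ ℝ) :
    0 ≤ c.sum fun s a => c.sum fun t b => a * b * (torusFourier (G s.1 t.1) (t.2 - s.2)).re := by
  obtain ⟨μ, hμ, hdom, hpos⟩ := hG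
  have hint : ∀ s t : Fin d × (Fin ν → ℤ), Integrable (fun x => (c s * c t : ℂ) *
      (torusChar (t.2 - s.2) x * G.density μ x s.1 t.1)) μ := fun s t =>
    (integrable_torusChar_mul (ComplexMeasure.integrable_rnDeriv _ μ) _).const_mul _
  have hsum : ((c.sum fun s a => c.sum fun t b =>
      a * b * (torusFourier (G s.1 t.1) (t.2 - s.2)).re : ℝ)) =
      (∫ x, ∑ s ∈ c.support, ∑ t ∈ c.support, (c s * c t : ℂ) *
        (torusChar (t.2 - s.2) x * G.density μ x s.1 t.1) ∂μ).re := by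
    rw [integral_finsetSum _ fun s _ => integrable_finsetSum _ fun t _ => hint s t, Complex.re_sum]
    refine Finset.sum_congr rfl fun s _ => ?_
    rw [integral_finsetSum _ fun t _ => hint s t, Complex.re_sum]
    refine Finset.sum_congr rfl fun t _ => ?_
    rw [integral_const_mul, ← hdom.torusFourier_eq, ← Complex.ofReal_mul, Complex.re_ofReal_mul]
  rw [hsum, ← RCLike.re_eq_complex_re, ← integral_re (integrable_finsetSum _ fun s _ =>
    integrable_finsetSum _ fun t _ => hint s t)]
  refine integral_nonneg_of_ae ?_
  filter_upwards [hpos] with x hx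
  let z : Fin d × (Fin ν → ℤ) →₀ ℂ := Finsupp.onFinset c.support
    (fun s => (c s : ℂ) * torusChar s.2 x) fun s hs => by
      rw [Finsupp.mem_support_iff]; rintro h; simp [h] at hs
  -- Repeating rows and columns along `Prod.fst` preserves positivity and lets the form act on
  -- vectors indexed by pairs `(j, p)`.
  have h := (hx.submatrix (Prod.fst : Fin d × (Fin ν → ℤ) → Fin d)).2 z
  have hz : (z.sum fun s a => z.sum fun t b => star a *
      (G.density μ x).submatrix Prod.fst Prod.fst s t * b) = ∑ s ∈ c.support, ∑ t ∈ c.support,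
      (c s * c t : ℂ) * (torusChar (t.2 - s.2) x * G.density μ x s.1 t.1) := by
    rw [Finsupp.onFinset_sum _ (by simp)]
    refine Finset.sum_congr rfl fun s _ => ?_
    rw [Finsupp.onFinset_sum _ (by simp)]
    refine Finset.sum_congr rfl fun t _ => ?_
    simp only [Matrix.submatrix_apply, torusChar_sub, star_mul', Complex.star_def,
      Complex.conj_ofReal]
    ring
  rw [hz] at h
  exact (Complex.le_def.1 h).1

end MatrixMeasure

/-! ### Vector fields assembled from scalar Gaussian processes. -/

namespace RandomField

variable {ν d : ℕ} {Ω : Type*} [MeasurableSpace Ω] {P : Measure Ω}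

/-- The random field with given coordinate processes. -/
def ofCoords (Y : Fin d × (Fin ν → ℤ) → Ω → ℝ) : RandomField ν d Ω :=
  fun p ω => WithLp.toLp 2 fun j => Y (j, p) ω

variable {Y : Fin d × (Fin ν → ℤ) → Ω → ℝ}

theorem isGaussianProcess_ofCoords (hY : IsGaussianProcess Y P) :
    IsGaussianProcess (ofCoords Y) P := by
  classical
  refine hY.of_isGaussianProcess fun p => ⟨Finset.univ.image fun j : Fin d => (j, p),
    (PiLp.continuousLinearEquiv 2 ℝ fun _ : Fin d => ℝ).symm.toContinuousLinearMap.comp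
      (ContinuousLinearMap.pi fun j => ContinuousLinearMap.proj ⟨(j, p), by simp⟩), fun ω => ?_⟩
  rfl

theorem isCentered_ofCoords (hY : IsGaussianProcess Y P) (h0 : ∀ s, ∫ ω, Y s ω ∂P = 0) :
    (ofCoords Y).IsCentered P := fun p j =>
  ⟨(hY.hasGaussianLaw_eval (j, p)).integrable, h0 (j, p)⟩

theorem isStationary_ofCoords (hY : IsGaussianProcess Y P) (h0 : ∀ s, ∫ ω, Y s ω ∂P = 0)
    (hcov : ∀ j j' p q m, ∫ ω, Y (j, p + m) ω * Y (j', q + m) ω ∂P =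
      ∫ ω, Y (j, p) ω * Y (j', q) ω ∂P) : (ofCoords Y).IsStationary P := by
  classical
  intro m I
  -- An arbitrary reindexing `f` serves both the shifted and the unshifted family.
  have hvec : ∀ f : Fin d × I → Fin d × (Fin ν → ℤ),
      HasGaussianLaw (fun ω (s : Fin d × I) => Y (f s) ω) P := fun f => by
    let L : (Finset.univ.image f → ℝ) →L[ℝ] (Fin d × I → ℝ) := ContinuousLinearMap.pi fun s =>
      ContinuousLinearMap.proj ⟨f s, Finset.mem_image_of_mem f (Finset.mem_univ s)⟩
    exact (hY.hasGaussianLaw (Finset.univ.image f)).map_fun L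
  have h := identDistrib_of_hasGaussianLaw (hvec fun s => (s.1, s.2 + m)) (hvec fun s => (s.1, s.2))
    (fun s => h0 _) (fun s => h0 _) fun s t => hcov s.1 t.1 s.2 t.2 m
  have hm : Measurable fun (y : Fin d × I → ℝ) (p : I) =>
      (WithLp.toLp 2 fun j => y (j, p) : EuclideanSpace ℝ (Fin d)) := by fun_prop
  exact h.comp hm

theorem exists_gaussian_field (k : Fin d → Fin d → (Fin ν → ℤ) → ℝ)
    (hsymm : ∀ j j' p, k j' j (-p) = k j j' p)
    (hpos : ∀ c : Fin d × (Fin ν → ℤ) →₀ ℝ,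
      0 ≤ c.sum fun s a => c.sum fun t b => a * b * k s.1 t.1 (t.2 - s.2)) :
    ∃ (Ω : Type) (_ : MeasurableSpace Ω) (P : Measure Ω) (_ : IsProbabilityMeasure P)
      (Y : Fin d × (Fin ν → ℤ) → Ω → ℝ), IsGaussianProcess Y P ∧ (∀ s, ∫ ω, Y s ω ∂P = 0) ∧
        ∀ j j' p q, ∫ ω, Y (j, p) ω * Y (j', q) ω ∂P = k j j' (q - p) := by
  obtain ⟨Ω, mΩ, P, hP, Y, h1, h2, h3⟩ := exists_isGaussianProcess_of_kernel
    (fun s t : Fin d × (Fin ν → ℤ) => k s.1 t.1 (t.2 - s.2))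
    (fun s t => by rw [← hsymm, neg_sub]) hpos
  exact ⟨Ω, mΩ, P, hP, Y, h1, h2, fun j j' p q => h3 (j, p) (j', q)⟩

end RandomField

/-! ### The spectral representation and its converse. -/

theorem theorem2p2 (ν d : ℕ) :
    -- the spectral representation of a centered stationary field with finite second moments
    (∀ (Ω : Type*) [MeasurableSpace Ω] (P : Measure Ω) [IsProbabilityMeasure P]
        (X : RandomField ν d Ω),
        (∀ p, MemLp (X p) 2 P) → X.IsStationary P → X.IsCentered P →
        ∃ G : MatrixMeasure ν d,
          (∀ j j', HasFiniteTotalVariation (G j j')) ∧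
          (∀ j j' p, (X.corr P j j' p : ℂ) = torusFourier (G j j') p ∧
            ∀ m, X.mixedMoment P j j' m (m + p) = X.corr P j j' p) ∧
          G.IsHermitian ∧ G.IsEven ∧
          (∀ j j' (H : ComplexMeasure (Torus ν)),
            (∀ p, (X.corr P j j' p : ℂ) = torusFourier H p) → H = G j j') ∧
          (∃ μ : Measure (Torus ν), IsFiniteMeasure μ ∧ G.IsDominatedBy μ) ∧
          (∀ μ : Measure (Torus ν), IsFiniteMeasure μ → G.IsDominatedBy μ →
            ∀ᵐ x ∂μ, (G.density μ x).PosSemidef)) ∧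
    -- the converse, for both orders of the arguments in the covariance
    (∀ G : MatrixMeasure ν d, G.IsPosSemidef → G.IsEven →
        (∃ (Ω : Type) (_ : MeasurableSpace Ω) (P : Measure Ω) (_ : IsProbabilityMeasure P)
          (X : RandomField ν d Ω),
          IsGaussianProcess X P ∧ X.IsStationary P ∧ X.IsCentered P ∧
          ∀ j j' p q, (X.mixedMoment P j j' p q : ℂ) = torusFourier (G j j') (q - p)) ∧
        (∃ (Ω : Type) (_ : MeasurableSpace Ω) (P : Measure Ω) (_ : IsProbabilityMeasure P)
          (X : RandomField ν d Ω),
          IsGaussianProcess X P ∧ X.IsStationary P ∧ X.IsCentered P ∧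
          ∀ j j' p q, (X.mixedMoment P j j' p q : ℂ) = torusFourier (G j j') (p - q))) := by
  refine ⟨fun Ω _ P _ X hX hs _ => RandomField.exists_spectral_measure hX hs, fun G hG he => ?_⟩
  obtain ⟨Ω, mΩ, P, hP, Y, hY, h0, hcov⟩ := RandomField.exists_gaussian_field
    (fun j j' p => (torusFourier (G j j') p).re)
    (fun j j' p => by rw [hG.torusFourier_swap, Complex.conj_re]) hG.sum_nonneg
  refine ⟨⟨Ω, mΩ, P, hP, RandomField.ofCoords Y, RandomField.isGaussianProcess_ofCoords hY,
    RandomField.isStationary_ofCoords hY h0 fun j j' p q m => ?_,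
    RandomField.isCentered_ofCoords hY h0, fun j j' p q => ?_⟩, ?_⟩
  · rw [hcov, hcov, add_sub_add_right_eq_sub]
  · rw [← he.ofReal_re_torusFourier, ← hcov]
    rfl
  -- Reflecting the lattice turns the lag `q - p` into `p - q`, so the same process serves.
  · have hY' := hY.comp_right fun s : Fin d × (Fin ν → ℤ) => (s.1, -s.2)
    refine ⟨Ω, mΩ, P, hP, RandomField.ofCoords fun s => Y (s.1, -s.2),
      RandomField.isGaussianProcess_ofCoords hY',
      RandomField.isStationary_ofCoords hY' (fun s => h0 _) fun j j' p q m => ?_,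
      RandomField.isCentered_ofCoords hY' fun s => h0 _, fun j j' p q => ?_⟩
    · have h : -(q + m) - -(p + m) = -q - -p := by abel
      simp only
      rw [hcov, hcov, h]
    · have h : p - q = -q - -p := by abel
      rw [← he.ofReal_re_torusFourier, h, ← hcov]
      rfl
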